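/- Let $K$ be an algebraically closed field (of any characteristic) and let $G$ be an algebraic group over $K$, that is, a group variety over $K$ (a reduced group scheme of finite type over $K$, not assumed affine or connected), identified with its group $G(K)$ of $K$-points endowed with the Zariski topology. Algebraic subgroups of $G$ are the Zariski-closed subgroups. For subgroups $P, H_1,\dots,H_k$ of $G$, write $P = H_1\times\cdots\times H_k$ if $P$ is, as an abstract group, the internal direct product of its subgroups $H_1,\dots,H_k$. An algebraic subgroup $H$ of $G$ is called indecomposable (as an algebraic group) if $H\neq\{1\}$ and, whenever $H = H_1\times H_2$ with $H_1,H_2$ algebraic subgroups, $H_1=\{1\}$ or $H_2=\{1\}$. An abstract group $\Gamma$ is called indecomposable if $\Gamma\neq\{1\}$ and, for every isomorphism $\Gamma\cong\Gamma_1\times\Gamma_2$ with groups $\Gamma_1,\Gamma_2$, one of $\Gamma_1,\Gamma_2$ is trivial. Suppose that the center of $G$ is $\{1\}$. (1) Let $G_1,\dots,G_n$ ($n\ge 0$) be indecomposable algebraic subgroups of $G$ such that $G=G_1\times\cdots\times G_n$, and let $\Gamma$ be a Zariski-dense subgroup of $G$. If $A,B$ are subgroups of $\Gamma$ such that $\Gamma=A\times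 B$, then there exist a renumbering of the $G_i$ and an integer $m\in\{0,\dots,n\}$ such that $$A\subset G_1\times\cdots\times G_m\qquad\text{and}\qquad B\subset G_{m+1}\times\cdots\times G_n .$$ (2) In particular, if moreover $G$ is indecomposable as an algebraic group, then every Zariski-dense subgroup of $G$ is indecomposable as an abstract group. -/

import Mathlib

/-- A group is indecomposable if it is nontrivial and if, for every isomorphism with a direct
product of two groups, one of the two factors is trivial. (The factors embed in the group, so
that there is no loss in taking them in the same universe.) -/
def IsIndecomposableGroup.{u} (Γ : Type u) [Group Γ] : Prop :=
  Nontrivial Γ ∧ ∀ (Γ₁ Γ₂ : Type u) [Group Γ₁] [Group Γ₂],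
    Nonempty (Γ ≃* Γ₁ × Γ₂) → Subsingleton Γ₁ ∨ Subsingleton Γ₂

namespace Subgroup

/-- `P = A × B` (internal direct product of two subgroups): `A` and `B` commute elementwise,
meet trivially, and generate `P`. -/
structure IsDirectProd {G : Type*} [Group G] (P A B : Subgroup G) : Prop where
  commute : ∀ a ∈ A, ∀ b ∈ B, Commute a b
  disjoint : A ⊓ B = ⊥
  sup_eq : A ⊔ B = P

/-- `P = H₁ × ⋯ × Hₙ` (internal direct product of a family of subgroups): distinct members
commute elementwise, each one meets the subgroup generated by the others trivially, and
together they generate `P`. -/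
structure IsDirectProdFamily {G : Type*} [Group G] {ι : Type*} (P : Subgroup G)
    (H : ι → Subgroup G) : Prop where
  commute : ∀ i j, i ≠ j → ∀ x ∈ H i, ∀ y ∈ H j, Commute x y
  disjoint : ∀ i, H i ⊓ (⨆ j, ⨆ _ : j ≠ i, H j) = ⊥
  iSup_eq : ⨆ i, H i = P

end Subgroup

namespace AlgebraicGeometry

open CategoryTheory MonoidalCategory

variable {K : Type*} [Field K]

/-- The `K`-points `Spec K ⟶ G` over `K` of a `K`-scheme `G`
(the monoidal unit of `Over (Spec K)` is `Spec K` itself). -/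
def KPoints (G : Over (Spec (.of K))) : Type _ := 𝟙_ (Over (Spec (.of K))) ⟶ G

namespace KPoints

/-- The point of the underlying space of `G` given by a `K`-point. For `K` algebraically closed
and `G` locally of finite type, this identifies `KPoints G` with the set of closed points. -/
noncomputable def toPoint {G : Over (Spec (.of K))} (x : KPoints G) : G.left :=
  (CommaMorphism.left x) (IsLocalRing.closedPoint K)

/-- The Zariski topology on the `K`-points. -/
noncomputable instance (G : Over (Spec (.of K))) : TopologicalSpace (KPoints G) :=
  TopologicalSpace.induced toPoint inferInstance

/-- The group structure on the `K`-points of a group scheme. -/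
noncomputable instance (G : Over (Spec (.of K))) [GrpObj G] : Group (KPoints G) :=
  Hom.group (X := 𝟙_ (Over (Spec (.of K)))) (G := G)

end KPoints

/-- The classical notion of an algebraic group over an algebraically closed field: a group
object in the category of varieties, i.e. of reduced schemes of finite type over `K`. It need
be neither affine nor connected. (A group scheme over a field is automatically separated.) -/
class IsAlgebraicGroup (G : Over (Spec (.of K))) [GrpObj G] : Prop where
  isReduced : IsReduced G.left
  locallyOfFiniteType : LocallyOfFiniteType G.hom
  quasiCompact : QuasiCompact G.hom

/-- Algebraic subgroups are the Zariski-closed subgroups of the group of `K`-points. -/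
def IsAlgebraicSubgroup {G : Over (Spec (.of K))} [GrpObj G] (H : Subgroup (KPoints G)) : Prop :=
  IsClosed (H : Set (KPoints G))

/-- A subgroup is Zariski-dense if it is dense in the Zariski topology. -/
def IsZariskiDense {G : Over (Spec (.of K))} [GrpObj G] (Γ : Subgroup (KPoints G)) : Prop :=
  Dense (Γ : Set (KPoints G))

/-- An algebraic group (given as an algebraic subgroup `H` of some `G`) is indecomposable
if it is nontrivial and not a direct product of two nontrivial algebraic subgroups. -/
structure IsIndecomposableAlgebraic {G : Over (Spec (.of K))} [GrpObj G]
    (H : Subgroup (KPoints G)) : Prop where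
  isAlgebraicSubgroup : IsAlgebraicSubgroup H
  ne_bot : H ≠ ⊥
  eq_bot_or_eq_bot : ∀ A B : Subgroup (KPoints G), IsAlgebraicSubgroup A →
    IsAlgebraicSubgroup B → H.IsDirectProd A B → A = ⊥ ∨ B = ⊥

end AlgebraicGeometry

open CategoryTheory AlgebraicGeometry

/-! ### Direct products in centerless groups. -/

namespace Subgroup

variable {G : Type*} [Group G]

/-! Put B' = C(A) and A' = C(B'): closed, mutually commuting subgroups containing B and A. An
element of A' ∩ B' centralizes the dense subgroup Γ, hence G, so it is trivial. By Chevalley the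
dense subgroup A'B' is constructible, so it contains a nonempty open set; it is then open, hence
closed, hence G. Thus G = A' × B' (`exists_isDirectProd_top_of_dense`). In a centerless group each
direct factor H i splits as (H i ∩ A') × (H i ∩ B') (`IsDirectProd.inf_isDirectProd_inf`), so
indecomposability puts H i inside A' or B'. Grouping the factors accordingly recovers A' and B'
exactly. Part (2) is the case n = 1. -/

theorem exists_mul_eq_of_mem_sup_of_commute {A B : Subgroup G}
    (hAB : ∀ a ∈ A, ∀ b ∈ B, Commute a b) {x : G} (hx : x ∈ A ⊔ B) :
    ∃ a ∈ A, ∃ b ∈ B, a * b = x := by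
  rw [sup_eq_closure] at hx
  induction hx using closure_induction with
  | mem x hx =>
    rcases hx with hx | hx
    · exact ⟨x, hx, 1, B.one_mem, mul_one x⟩
    · exact ⟨1, A.one_mem, x, hx, one_mul x⟩
  | one => exact ⟨1, A.one_mem, 1, B.one_mem, mul_one 1⟩
  | mul x y _ _ ihx ihy =>
    obtain ⟨a, ha, b, hb, rfl⟩ := ihx
    obtain ⟨c, hc, d, hd, rfl⟩ := ihy
    exact ⟨a * c, A.mul_mem ha hc, b * d, B.mul_mem hb hd, (hAB c hc b hb).mul_mul_mul_comm a d⟩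
  | inv x _ ih =>
    obtain ⟨a, ha, b, hb, rfl⟩ := ih
    exact ⟨a⁻¹, A.inv_mem ha, b⁻¹, B.inv_mem hb, by
      rw [mul_inv_rev, (hAB _ (A.inv_mem ha) _ (B.inv_mem hb)).eq]⟩

/-- In a centerless group `C × D`, the centralizer of `D` is `C`. -/
theorem mem_of_commute_of_center_eq_bot (hZ : center G = ⊥) {C D : Subgroup G}
    (hCD : ∀ c ∈ C, ∀ d ∈ D, Commute c d) (htop : C ⊔ D = ⊤) {x : G}
    (hx : ∀ d ∈ D, Commute x d) : x ∈ C := by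
  obtain ⟨c, hc, d, hd, rfl⟩ := exists_mul_eq_of_mem_sup_of_commute hCD (x := x) (htop ▸ mem_top x)
  -- `d` commutes with `C` by hypothesis, and with `D` because `c` and `c * d` do.
  have hd1 : d ∈ center G := by
    rw [mem_center_iff]
    intro g
    obtain ⟨c', hc', d', hd', rfl⟩ :=
      exists_mul_eq_of_mem_sup_of_commute hCD (x := g) (htop ▸ mem_top g)
    have h1 : Commute d d' := by
      have := ((hCD c hc d' hd').inv_left).mul_left (hx d' hd')
      simpa using this
    exact ((hCD c' hc' d hd).mul_left h1.symm).eq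
  rw [hZ, mem_bot] at hd1
  simpa [hd1] using hc

/-- A direct factor of a centerless group is compatible with every direct product decomposition. -/
theorem IsDirectProd.inf_isDirectProd_inf (hZ : center G = ⊥) {A B C D : Subgroup G}
    (h : (⊤ : Subgroup G).IsDirectProd A B) (hCD : ∀ c ∈ C, ∀ d ∈ D, Commute c d)
    (htop : C ⊔ D = ⊤) : C.IsDirectProd (C ⊓ A) (C ⊓ B) where
  commute a ha b hb := h.commute a ha.2 b hb.2
  disjoint := by
    rw [eq_bot_iff, ← h.disjoint]
    exact inf_le_inf inf_le_right inf_le_right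
  sup_eq := by
    refine le_antisymm (sup_le inf_le_left inf_le_left) fun c hc ↦ ?_
    obtain ⟨a, ha, b, hb, rfl⟩ :=
      exists_mul_eq_of_mem_sup_of_commute h.commute (x := c) (h.sup_eq ▸ mem_top c)
    have haC : a ∈ C := by
      refine mem_of_commute_of_center_eq_bot hZ hCD htop fun d hd ↦ ?_
      obtain ⟨a', ha', b', hb', rfl⟩ :=
        exists_mul_eq_of_mem_sup_of_commute h.commute (x := d) (h.sup_eq ▸ mem_top d)
      -- Compare the `A`-components of the two sides of cd = dc.
      have hcomm : Commute a a' := by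
        have e : (a * a') * (b * b') = (a' * a) * (b' * b) := by
          have := (hCD _ hc _ hd).eq
          rwa [(h.commute a' ha' b hb).symm.mul_mul_mul_comm a b',
            (h.commute a ha b' hb').symm.mul_mul_mul_comm a' b] at this
        have e2 : (a' * a)⁻¹ * (a * a') = (b' * b) * (b * b')⁻¹ := by
          rw [inv_mul_eq_iff_eq_mul, ← mul_assoc, eq_mul_inv_iff_mul_eq, e]
        have hmem : (a' * a)⁻¹ * (a * a') ∈ A ⊓ B :=
          ⟨A.mul_mem (A.inv_mem (A.mul_mem ha' ha)) (A.mul_mem ha ha'),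
            e2 ▸ B.mul_mem (B.mul_mem hb' hb) (B.inv_mem (B.mul_mem hb hb'))⟩
        rw [h.disjoint, mem_bot, inv_mul_eq_one] at hmem
        exact hmem.symm
      exact hcomm.mul_right (h.commute a ha b' hb')
    have hbC : b ∈ C := by simpa using C.mul_mem (C.inv_mem haC) hc
    exact mul_mem_sup ⟨haC, ha⟩ ⟨hbC, hb⟩

theorem IsDirectProd.le_of_le_of_sup_eq_top {A B P Q : Subgroup G}
    (h : (⊤ : Subgroup G).IsDirectProd A B) (hP : P ≤ A) (hQ : Q ≤ B) (hPQ : P ⊔ Q = ⊤) :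
    A ≤ P ∧ B ≤ Q := by
  have hcomm : ∀ p ∈ P, ∀ q ∈ Q, Commute p q := fun p hp q hq ↦ h.commute p (hP hp) q (hQ hq)
  constructor
  · intro a ha
    obtain ⟨p, hp, q, hq, rfl⟩ :=
      exists_mul_eq_of_mem_sup_of_commute hcomm (x := a) (hPQ ▸ mem_top a)
    have hq1 : q ∈ A ⊓ B := ⟨by simpa using A.mul_mem (A.inv_mem (hP hp)) ha, hQ hq⟩
    rw [h.disjoint, mem_bot] at hq1
    simpa [hq1] using hp
  · intro b hb
    obtain ⟨p, hp, q, hq, rfl⟩ :=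
      exists_mul_eq_of_mem_sup_of_commute hcomm (x := b) (hPQ ▸ mem_top b)
    have hp1 : p ∈ A ⊓ B := ⟨hP hp, by simpa using B.mul_mem hb (B.inv_mem (hQ hq))⟩
    rw [h.disjoint, mem_bot] at hp1
    simpa [hp1] using hq

theorem IsDirectProdFamily.commute_iSup {ι : Type*} {P : Subgroup G} {H : ι → Subgroup G}
    (h : P.IsDirectProdFamily H) (i : ι) :
    ∀ c ∈ H i, ∀ d ∈ (⨆ j, ⨆ _ : j ≠ i, H j), Commute c d := by
  intro c hc d hd
  have hle : (⨆ j, ⨆ _ : j ≠ i, H j) ≤ centralizer {c} :=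
    iSup₂_le fun j hj y hy ↦ mem_centralizer_singleton_iff.2 (h.commute j i hj y hy c hc).eq
  exact (mem_centralizer_singleton_iff.1 (hle hd)).symm

theorem iSup_sup_iSup_not_eq {ι : Type*} (H : ι → Subgroup G) (p : ι → Prop) :
    (⨆ j, ⨆ _ : p j, H j) ⊔ (⨆ j, ⨆ _ : ¬ p j, H j) = ⨆ i, H i := by
  refine le_antisymm (sup_le (iSup₂_le fun i _ ↦ le_iSup H i) (iSup₂_le fun i _ ↦ le_iSup H i))
    (iSup_le fun i ↦ ?_)
  by_cases hi : p i
  · exact le_sup_of_le_left (le_iSup₂_of_le i hi le_rfl)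
  · exact le_sup_of_le_right (le_iSup₂_of_le i hi le_rfl)

theorem IsDirectProdFamily.sup_iSup_ne {ι : Type*} {P : Subgroup G} {H : ι → Subgroup G}
    (h : P.IsDirectProdFamily H) (i : ι) : H i ⊔ (⨆ j, ⨆ _ : j ≠ i, H j) = P := by
  rw [← h.iSup_eq, ← iSup_sup_iSup_not_eq H (· = i), iSup_iSup_eq_left]

end Subgroup

/-- Supplies the renumbering: the indices satisfying `p` are moved to the front. -/
theorem Fin.exists_perm_lt_iff {n : ℕ} (p : Fin n → Prop) :
    ∃ (σ : Equiv.Perm (Fin n)) (m : ℕ), m ≤ n ∧ ∀ i, p (σ i) ↔ (i : ℕ) < m := by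
  classical
  let m := Fintype.card {i // p i}
  have hm : m ≤ n := by simpa using Fintype.card_subtype_le p
  have hcard : Fintype.card {i : Fin n // (i : ℕ) < m} = Fintype.card {i // p i} := by
    rw [Fintype.card_subtype, Fin.card_filter_val_lt, min_eq_right hm]
  let e := Fintype.equivOfCardEq hcard
  refine ⟨e.extendSubtype, m, hm, fun i ↦ ⟨fun hi ↦ ?_, fun hi ↦ e.extendSubtype_mem i hi⟩⟩
  by_contra hlt
  exact e.extendSubtype_not_mem i hlt hi

/-! ### Constructible sets. -/

open Topology

/-- Open sets have nowhere dense frontier; this survives complements, and also unions, since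
frontiers are closed. -/
theorem Topology.IsConstructible.interior_frontier_eq_empty {X : Type*} [TopologicalSpace X]
    {s : Set X} (hs : IsConstructible s) : interior (frontier s) = ∅ := by
  induction hs using IsConstructible.empty_union_induction with
  | open_retrocompact U hU _ =>
    rw [← frontier_compl]
    exact interior_frontier hU.isClosed_compl
  | union s _ t _ hs ht =>
    have h := interior_union_isClosed_of_interior_empty (s := frontier s) isClosed_frontier ht
    rw [hs] at h
    refine Set.subset_eq_empty (interior_mono ((frontier_union_subset s t).trans ?_)) h
    exact Set.union_subset_union Set.inter_subset_left Set.inter_subset_right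
  | compl s _ hs => rwa [frontier_compl]

theorem Topology.IsConstructible.interior_nonempty_of_dense {X : Type*} [TopologicalSpace X]
    [Nonempty X] {s : Set X} (hs : IsConstructible s) (hd : Dense s) : (interior s).Nonempty := by
  by_contra h
  have h1 := hs.interior_frontier_eq_empty
  rw [Set.not_nonempty_iff_eq_empty] at h
  rw [frontier, hd.closure_eq, h, Set.sdiff_empty, interior_univ] at h1
  exact Set.univ_nonempty.ne_empty h1

/-! ### Zariski topology and group law on K-points. -/

namespace AlgebraicGeometry

open CategoryTheory MonoidalCategory CartesianMonoidalCategory MonObj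

namespace KPoints

universe u

variable {K : Type u} [Field K] {G : Over (Spec (.of K))}

/-- The map on `K`-points induced by a morphism over `K`. -/
noncomputable def map {H : Over (Spec (.of K))} (f : G ⟶ H) (x : KPoints G) : KPoints H :=
  CategoryStruct.comp (obj := Over (Spec (.of K))) x f

theorem toPoint_map {H : Over (Spec (.of K))} (f : G ⟶ H) (x : KPoints G) :
    toPoint (map f x) = f.left (toPoint x) := rfl

theorem continuous_map {H : Over (Spec (.of K))} (f : G ⟶ H) : Continuous (map f) :=
  continuous_induced_rng.2 (f.left.continuous.comp continuous_induced_dom)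

/-- The `K`-point of a product given by a pair of `K`-points. -/
noncomputable def pair {H : Over (Spec (.of K))} (x : KPoints G) (y : KPoints H) : KPoints (G ⊗ H) :=
  CartesianMonoidalCategory.lift (C := Over (Spec (.of K))) x y

theorem map_fst_pair {H : Over (Spec (.of K))} (x : KPoints G) (y : KPoints H) :
    map (fst G H) (pair x y) = x :=
  CartesianMonoidalCategory.lift_fst (C := Over (Spec (.of K))) _ _

theorem map_snd_pair {H : Over (Spec (.of K))} (x : KPoints G) (y : KPoints H) :
    map (snd G H) (pair x y) = y :=
  CartesianMonoidalCategory.lift_snd (C := Over (Spec (.of K))) _ _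

theorem pair_map_fst_map_snd {H : Over (Spec (.of K))} (x : KPoints (G ⊗ H)) :
    pair (map (fst G H) x) (map (snd G H) x) = x :=
  CartesianMonoidalCategory.lift_comp_fst_snd (C := Over (Spec (.of K))) _

theorem map_id (x : KPoints G) : map (𝟙 G) x = x :=
  Category.comp_id (obj := Over (Spec (.of K))) _

theorem map_toUnit_comp (a x : KPoints G) :
    map (CategoryStruct.comp (obj := Over (Spec (.of K))) (toUnit G) a) x = a := by
  have h (x a : 𝟙_ (Over (Spec (.of K))) ⟶ G) : x ≫ toUnit G ≫ a = a := by
    rw [← Category.assoc, toUnit_unique (x ≫ toUnit G) (𝟙 _), Category.id_comp]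
  exact h x a

section Points

variable [IsAlgClosed K] [LocallyOfFiniteType G.hom]

theorem isClosed_singleton_toPoint (x : KPoints G) : IsClosed {toPoint x} :=
  (pointEquivClosedPoint G.hom ⟨x.left, Over.w x⟩).2

theorem exists_toPoint_eq {y : G.left} (hy : IsClosed {y}) : ∃ x : KPoints G, toPoint x = y :=
  ⟨Over.homMk (pointOfClosedPoint G.hom y hy) (pointOfClosedPoint_comp G.hom y hy),
    pointOfClosedPoint_apply G.hom y hy _⟩

theorem toPoint_injective : Function.Injective (toPoint (G := G)) := fun x y h ↦
  Over.OverMorphism.ext (ext_of_apply_closedPoint_eq G.hom (Over.w x) (Over.w y) h)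

instance : T1Space (KPoints G) where
  t1 x := by
    have : ({x} : Set (KPoints G)) = toPoint ⁻¹' {toPoint x} := by
      ext y
      exact toPoint_injective.eq_iff.symm
    rw [this]
    exact (isClosed_singleton_toPoint x).preimage continuous_induced_dom

/-- The scheme is Jacobson, and over an algebraically closed field its closed points are K-points.
-/
theorem exists_toPoint_mem {Z : Set G.left} (hZ : Z.Nonempty) (hZ' : IsLocallyClosed Z) :
    ∃ x : KPoints G, toPoint x ∈ Z := by
  have : JacobsonSpace G.left := LocallyOfFiniteType.jacobsonSpace (Y := Spec _) G.hom
  obtain ⟨y, hyZ, hy⟩ := nonempty_inter_closedPoints hZ hZ'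
  obtain ⟨x, rfl⟩ := exists_toPoint_eq hy
  exact ⟨x, hyZ⟩

theorem dense_image_toPoint {S : Set (KPoints G)} (hS : Dense S) : Dense (toPoint '' S) := by
  rw [dense_iff_inter_open]
  intro U hU hne
  obtain ⟨x, hx⟩ := exists_toPoint_mem hne hU.isLocallyClosed
  obtain ⟨y, hyU, hyS⟩ := hS.inter_open_nonempty (toPoint ⁻¹' U)
    (hU.preimage continuous_induced_dom) ⟨x, hx⟩
  exact ⟨toPoint y, hyU, y, hyS, rfl⟩

end Points

section Group

variable [GrpObj G]

theorem map_mul_pair (x y : KPoints G) : map μ[G] (pair x y) = x * y := rfl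

theorem map_mul (f g : G ⟶ G) (x : KPoints G) : map (f * g) x = map f x * map g x :=
  MonObj.comp_mul (C := Over (Spec (.of K))) _ _ _

theorem map_inv (f : G ⟶ G) (x : KPoints G) : map f⁻¹ x = (map f x)⁻¹ :=
  GrpObj.comp_inv (C := Over (Spec (.of K))) _ _

/-- The Zariski topology rarely makes multiplication jointly continuous, so the translation is
realized as a scheme morphism: the constant `a` times the identity in Hom(G, G). -/
theorem continuous_const_mul (a : KPoints G) : Continuous fun x ↦ a * x := by
  have h := continuous_map (CategoryStruct.comp (obj := Over (Spec (.of K))) (toUnit G) a * 𝟙 G)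
  convert h using 2 with x
  rw [map_mul, map_toUnit_comp, map_id]

theorem continuous_conj (a : KPoints G) : Continuous fun x ↦ x * a * x⁻¹ := by
  have h := continuous_map
    (𝟙 G * CategoryStruct.comp (obj := Over (Spec (.of K))) (toUnit G) a * (𝟙 G)⁻¹)
  convert h using 2 with x
  rw [map_mul, map_mul, map_inv, map_toUnit_comp, map_id]

theorem isClosed_centralizer [IsAlgClosed K] [LocallyOfFiniteType G.hom] (S : Set (KPoints G)) :
    IsClosed (Subgroup.centralizer S : Set (KPoints G)) := by
  have : (Subgroup.centralizer S : Set (KPoints G)) = ⋂ a ∈ S, (fun x ↦ x * a * x⁻¹) ⁻¹' {a} := by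
    ext x
    rw [SetLike.mem_coe, Subgroup.mem_centralizer_iff, Set.mem_iInter₂]
    exact forall₂_congr fun a _ ↦ eq_comm.trans mul_inv_eq_iff_eq_mul.symm
  rw [this]
  exact isClosed_biInter fun a _ ↦ isClosed_singleton.preimage (continuous_conj a)

theorem isOpen_of_interior_nonempty {P : Subgroup (KPoints G)}
    (h : (interior (P : Set (KPoints G))).Nonempty) : IsOpen (P : Set (KPoints G)) := by
  obtain ⟨u, hu⟩ := h
  rw [isOpen_iff_mem_nhds]
  intro x hx
  have hc := continuous_const_mul (u * x⁻¹)
  refine Filter.mem_of_superset ((isOpen_interior.preimage hc).mem_nhds (by simpa using hu)) ?_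
  intro y hy
  have huP : u ∈ P := interior_subset hu
  have hyP : u * x⁻¹ * y ∈ P := interior_subset hy
  exact (P.mul_mem_cancel_left (P.mul_mem huP (P.inv_mem hx))).1 hyP

theorem isClosed_of_isOpen {P : Subgroup (KPoints G)} (h : IsOpen (P : Set (KPoints G))) :
    IsClosed (P : Set (KPoints G)) := by
  rw [← isOpen_compl_iff, isOpen_iff_mem_nhds]
  intro x hx
  have hc := continuous_const_mul x⁻¹
  refine Filter.mem_of_superset ((h.preimage hc).mem_nhds (by simp [P.one_mem])) ?_
  intro y hy hyP
  have hy : x⁻¹ * y ∈ P := hy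
  exact hx (inv_mem_iff.1 ((P.mul_mem_cancel_right hyP).1 hy))

/-- Chevalley's theorem for multiplication, which is of finite presentation because the schemes are
noetherian. -/
theorem isConstructible_image_mul [IsAlgebraicGroup G] {Z W : Set G.left} (hZ : IsClosed Z)
    (hW : IsClosed W) :
    IsConstructible (μ[G].left '' ((fst G G).left ⁻¹' Z ∩ (snd G G).left ⁻¹' W)) := by
  have := IsAlgebraicGroup.locallyOfFiniteType (G := G)
  have := IsAlgebraicGroup.quasiCompact (G := G)
  have : LocallyOfFiniteType (G ⊗ G).hom := by dsimp; infer_instance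
  have : QuasiCompact (G ⊗ G).hom := by dsimp; infer_instance
  have hG : IsLocallyNoetherian G.left :=
    LocallyOfFiniteType.isLocallyNoetherian (Y := Spec (.of K)) G.hom
  have hGG : IsLocallyNoetherian (G ⊗ G).left :=
    LocallyOfFiniteType.isLocallyNoetherian (Y := Spec (.of K)) (G ⊗ G).hom
  have : CompactSpace G.left := QuasiCompact.compactSpace_of_compactSpace (Y := Spec (.of K)) G.hom
  have : CompactSpace (G ⊗ G).left :=
    QuasiCompact.compactSpace_of_compactSpace (Y := Spec (.of K)) (G ⊗ G).hom
  have : IsNoetherian G.left := {}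
  have : IsNoetherian (G ⊗ G).left := {}
  have : LocallyOfFiniteType (μ[G].left ≫ G.hom) := by rw [Over.w]; infer_instance
  have : LocallyOfFiniteType μ[G].left := locallyOfFiniteType_of_comp _ G.hom
  have : LocallyOfFinitePresentation μ[G].left := by
    rwa [LocallyOfFinitePresentation.iff_locallyOfFiniteType]
  refine Scheme.Hom.isConstructible_image _ ?_
  rw [← isConstructible_compl]
  refine IsCompact.isConstructible (TopologicalSpace.NoetherianSpace.isCompact _) ?_
  exact ((hZ.preimage (fst G G).left.continuous).inter
    (hW.preimage (snd G G).left.continuous)).isOpen_compl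

/-- The `K`-points in the image of a product of closed subsets under multiplication. -/
theorem exists_mul_eq_of_toPoint_mem_image [IsAlgClosed K] [IsAlgebraicGroup G]
    {A B : Set (KPoints G)} {Z W : Set G.left}
    (hZ : IsClosed Z) (hW : IsClosed W) (hAZ : toPoint ⁻¹' Z = A) (hBW : toPoint ⁻¹' W = B)
    {x : KPoints G}
    (hx : toPoint x ∈ μ[G].left '' ((fst G G).left ⁻¹' Z ∩ (snd G G).left ⁻¹' W)) :
    ∃ a ∈ A, ∃ b ∈ B, a * b = x := by
  have := IsAlgebraicGroup.locallyOfFiniteType (G := G)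
  have : LocallyOfFiniteType (G ⊗ G).hom := by dsimp; infer_instance
  obtain ⟨z, hz, hzx⟩ := hx
  -- The part of the fibre over `x` lying in Z × W is closed and nonempty, so it has a K-point; its
  -- coordinates are `a` and `b`.
  have hcl : IsClosed (((fst G G).left ⁻¹' Z ∩ (snd G G).left ⁻¹' W) ∩
      μ[G].left ⁻¹' {toPoint x}) :=
    ((hZ.preimage (fst G G).left.continuous).inter (hW.preimage (snd G G).left.continuous)).inter
      ((isClosed_singleton_toPoint x).preimage μ[G].left.continuous)
  obtain ⟨w, ⟨hwZ, hwW⟩, hwx⟩ := exists_toPoint_mem (G := G ⊗ G)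
    (Set.nonempty_of_mem (Set.mem_inter hz hzx)) hcl.isLocallyClosed
  refine ⟨map (fst G G) w, hAZ ▸ hwZ, map (snd G G) w, hBW ▸ hwW, toPoint_injective ?_⟩
  rw [← map_mul_pair, pair_map_fst_map_snd]
  exact hwx

/-- A dense subgroup that is the product of two commuting closed subgroups is everything. -/
theorem sup_eq_top_of_dense [IsAlgClosed K] [IsAlgebraicGroup G] {A B : Subgroup (KPoints G)}
    (hA : IsClosed (A : Set (KPoints G))) (hB : IsClosed (B : Set (KPoints G)))
    (hd : Dense ((A ⊔ B : Subgroup (KPoints G)) : Set (KPoints G)))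
    (hmul : ∀ x ∈ A ⊔ B, ∃ a ∈ A, ∃ b ∈ B, a * b = x) : A ⊔ B = ⊤ := by
  have := IsAlgebraicGroup.locallyOfFiniteType (G := G)
  obtain ⟨Z, hZ, hAZ⟩ := isClosed_induced_iff.1 hA
  obtain ⟨W, hW, hBW⟩ := isClosed_induced_iff.1 hB
  have hc := isConstructible_image_mul hZ hW
  have : Nonempty G.left := ⟨toPoint (1 : KPoints G)⟩
  obtain ⟨y, hy⟩ := hc.interior_nonempty_of_dense <| (dense_image_toPoint hd).mono <| by
    rintro _ ⟨x, hx, rfl⟩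
    obtain ⟨a, ha, b, hb, rfl⟩ := hmul x hx
    rw [← SetLike.mem_coe, ← hAZ] at ha
    rw [← SetLike.mem_coe, ← hBW] at hb
    refine ⟨toPoint (pair a b), ⟨?_, ?_⟩, rfl⟩
    · rw [Set.mem_preimage, ← toPoint_map, map_fst_pair]
      exact ha
    · rw [Set.mem_preimage, ← toPoint_map, map_snd_pair]
      exact hb
  obtain ⟨x, hx⟩ := exists_toPoint_mem ⟨y, hy⟩ isOpen_interior.isLocallyClosed
  have hopen := isOpen_of_interior_nonempty (P := A ⊔ B) ⟨x, mem_interior.2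
    ⟨toPoint ⁻¹' _, fun z hz ↦ ?_, isOpen_interior.preimage continuous_induced_dom, hx⟩⟩
  · rw [← SetLike.coe_set_eq, Subgroup.coe_top, ← hd.closure_eq]
    exact (isClosed_of_isOpen hopen).closure_eq.symm
  · obtain ⟨a, ha, b, hb, rfl⟩ := exists_mul_eq_of_toPoint_mem_image hZ hW hAZ hBW
      (interior_subset hz)
    exact Subgroup.mul_mem_sup ha hb

end Group

end KPoints

end AlgebraicGeometry

/-! ### Decompositions of dense subgroups. -/

namespace AlgebraicGeometry

open CategoryTheory

namespace KPoints

universe u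

variable {K : Type u} [Field K] [IsAlgClosed K] {G : Over (Spec (.of K))} [GrpObj G]
  [IsAlgebraicGroup G]

/-- In a centerless algebraic group, a direct decomposition of a dense subgroup extends to a
decomposition of the whole group into algebraic subgroups. -/
theorem exists_isDirectProd_top_of_dense (hZ : Subgroup.center (KPoints G) = ⊥)
    {Γ : Subgroup (KPoints G)} (hΓ : IsZariskiDense Γ) {A B : Subgroup (KPoints G)}
    (h : Γ.IsDirectProd A B) :
    ∃ A' B' : Subgroup (KPoints G), IsAlgebraicSubgroup A' ∧ IsAlgebraicSubgroup B' ∧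
      A ≤ A' ∧ B ≤ B' ∧ (⊤ : Subgroup (KPoints G)).IsDirectProd A' B' := by
  have := IsAlgebraicGroup.locallyOfFiniteType (G := G)
  let B' := Subgroup.centralizer (A : Set (KPoints G))
  let A' := Subgroup.centralizer (B' : Set (KPoints G))
  have hA'c : IsClosed (A' : Set (KPoints G)) := isClosed_centralizer _
  have hB'c : IsClosed (B' : Set (KPoints G)) := isClosed_centralizer _
  have hA : A ≤ A' := Subgroup.le_centralizer_iff.1 le_rfl
  have hB : B ≤ B' := fun b hb a ha ↦ h.commute a ha b hb
  have hcomm : ∀ a ∈ A', ∀ b ∈ B', Commute a b := fun a ha b hb ↦ (ha b hb).symm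
  have hdense : Dense ((A' ⊔ B' : Subgroup (KPoints G)) : Set (KPoints G)) :=
    Dense.mono (SetLike.coe_subset_coe.2 (h.sup_eq ▸ sup_le_sup hA hB)) hΓ
  refine ⟨A', B', hA'c, hB'c, hA, hB, hcomm, ?_,
    sup_eq_top_of_dense hA'c hB'c hdense fun x hx ↦
      Subgroup.exists_mul_eq_of_mem_sup_of_commute hcomm hx⟩
  rw [eq_bot_iff, ← hZ]
  intro x hx
  -- `x` commutes with `A` as a member of `B'`, and with `B ≤ B'` as a member of `A'`.
  have hΓx : Γ ≤ Subgroup.centralizer {x} := by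
    rw [← h.sup_eq]
    refine sup_le (fun a ha ↦ ?_) fun b hb ↦ ?_
    · exact Subgroup.mem_centralizer_singleton_iff.2 (hx.2 a ha)
    · exact Subgroup.mem_centralizer_singleton_iff.2 (hx.1 b (hB hb))
  have htop := (Dense.mono (SetLike.coe_subset_coe.2 hΓx) hΓ).closure_eq
  rw [(isClosed_centralizer _).closure_eq] at htop
  refine Subgroup.mem_center_iff.2 fun g ↦ ?_
  exact Subgroup.mem_centralizer_singleton_iff.1 (htop ▸ Set.mem_univ g : g ∈ (_ : Set _))

theorem exists_perm_le_of_isDirectProd (hZ : Subgroup.center (KPoints G) = ⊥) {n : ℕ}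
    {H : Fin n → Subgroup (KPoints G)} (hH : ∀ i, IsIndecomposableAlgebraic (H i))
    (hprod : (⊤ : Subgroup (KPoints G)).IsDirectProdFamily H)
    {Γ : Subgroup (KPoints G)} (hΓ : IsZariskiDense Γ) {A B : Subgroup (KPoints G)}
    (h : Γ.IsDirectProd A B) :
    ∃ (σ : Equiv.Perm (Fin n)) (m : ℕ), m ≤ n ∧
      A ≤ (⨆ i : Fin n, ⨆ _ : (i : ℕ) < m, H (σ i)) ∧
      B ≤ (⨆ i : Fin n, ⨆ _ : m ≤ (i : ℕ), H (σ i)) := by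
  obtain ⟨A', B', hA', hB', hAA', hBB', hd⟩ := exists_isDirectProd_top_of_dense hZ hΓ h
  have hle (i : Fin n) (hi : ¬ H i ≤ A') : H i ≤ B' := by
    have hi' := hd.inf_isDirectProd_inf hZ (hprod.commute_iSup i) (hprod.sup_iSup_ne i)
    rcases (hH i).eq_bot_or_eq_bot (H i ⊓ A') (H i ⊓ B') (IsClosed.inter (hH i).isAlgebraicSubgroup hA')
      (IsClosed.inter (hH i).isAlgebraicSubgroup hB') hi' with e | e
    · rw [← inf_eq_left]
      simpa [e] using hi'.sup_eq
    · refine (hi ?_).elim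
      rw [← inf_eq_left]
      simpa [e] using hi'.sup_eq
  obtain ⟨σ, m, hm, hσ⟩ := Fin.exists_perm_lt_iff fun i ↦ H i ≤ A'
  -- The two grouped products generate G and lie in `A'` and `B'`, so they equal them.
  have key := hd.le_of_le_of_sup_eq_top (P := ⨆ i : Fin n, ⨆ _ : (i : ℕ) < m, H (σ i))
    (Q := ⨆ i : Fin n, ⨆ _ : ¬ (i : ℕ) < m, H (σ i))
    (iSup₂_le fun i hi ↦ (hσ i).2 hi) (iSup₂_le fun i hi ↦ hle _ fun hi' ↦ hi ((hσ i).1 hi'))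
    (by rw [Subgroup.iSup_sup_iSup_not_eq fun i ↦ H (σ i), σ.iSup_comp (g := H), hprod.iSup_eq])
  simp only [not_lt] at key
  exact ⟨σ, m, hm, hAA'.trans key.1, hBB'.trans key.2⟩

theorem isIndecomposableGroup_of_dense (hZ : Subgroup.center (KPoints G) = ⊥)
    (htop : IsIndecomposableAlgebraic (⊤ : Subgroup (KPoints G)))
    {Γ : Subgroup (KPoints G)} (hΓ : IsZariskiDense Γ) : IsIndecomposableGroup Γ := by
  have := IsAlgebraicGroup.locallyOfFiniteType (G := G)
  constructor
  · rw [Subgroup.nontrivial_iff_ne_bot]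
    rintro rfl
    have h := Dense.closure_eq hΓ
    rw [Subgroup.coe_bot, isClosed_singleton.closure_eq, ← Subgroup.coe_bot, ← Subgroup.coe_top,
      SetLike.coe_set_eq] at h
    exact htop.ne_bot h.symm
  · rintro Γ₁ Γ₂ _ _ ⟨e⟩
    let f₁ : Γ₁ →* KPoints G := Γ.subtype.comp (e.symm.toMonoidHom.comp (MonoidHom.inl Γ₁ Γ₂))
    let f₂ : Γ₂ →* KPoints G := Γ.subtype.comp (e.symm.toMonoidHom.comp (MonoidHom.inr Γ₁ Γ₂))
    have hf₁ : Function.Injective f₁ := Γ.subtype_injective.comp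
      (e.symm.injective.comp fun _ _ h ↦ (Prod.ext_iff.1 h).1)
    have hf₂ : Function.Injective f₂ := Γ.subtype_injective.comp
      (e.symm.injective.comp fun _ _ h ↦ (Prod.ext_iff.1 h).2)
    have hprod : Γ.IsDirectProd f₁.range f₂.range := by
      refine ⟨?_, ?_, le_antisymm ?_ ?_⟩
      · rintro _ ⟨x, rfl⟩ _ ⟨y, rfl⟩
        exact ((MonoidHom.commute_inl_inr x y).map e.symm.toMonoidHom).map Γ.subtype
      · rw [eq_bot_iff]
        rintro _ ⟨⟨x, rfl⟩, ⟨y, hy⟩⟩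
        have hyx := e.symm.injective (Γ.subtype_injective hy)
        have hx : (1 : Γ₁) = x := (Prod.ext_iff.1 hyx).1
        rw [Subgroup.mem_bot, ← hx, map_one]
      · refine sup_le ?_ ?_ <;> rintro _ ⟨x, rfl⟩ <;> exact SetLike.coe_mem _
      · intro g hg
        have hg' : g = f₁ (e ⟨g, hg⟩).1 * f₂ (e ⟨g, hg⟩).2 := by
          change g = (Γ.subtype (e.symm (_, 1))) * (Γ.subtype (e.symm (1, _)))
          rw [← _root_.map_mul, ← _root_.map_mul, Prod.mk_mul_mk, mul_one, one_mul, Prod.mk.eta,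
            e.symm_apply_apply]
          rfl
        rw [hg']
        exact Subgroup.mul_mem_sup ⟨_, rfl⟩ ⟨_, rfl⟩
    have hfam : (⊤ : Subgroup (KPoints G)).IsDirectProdFamily
        fun _ : Fin 1 ↦ (⊤ : Subgroup (KPoints G)) := by
      refine ⟨fun i j hij ↦ (hij (Subsingleton.elim i j)).elim, fun i ↦ ?_, iSup_const⟩
      simp [Subsingleton.elim _ i]
    obtain ⟨σ, m, -, h₁, h₂⟩ := exists_perm_le_of_isDirectProd hZ (fun _ ↦ htop) hfam hΓ hprod
    -- With a single factor, `m = 0` makes the first product empty and `m > 0` the second.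
    rcases Nat.eq_zero_or_pos m with rfl | hm
    · left
      have hbot : f₁.range ≤ ⊥ := by simpa using h₁
      exact ⟨fun x y ↦ hf₁ ((hbot ⟨x, rfl⟩ : f₁ x = 1).trans (hbot ⟨y, rfl⟩ : f₁ y = 1).symm)⟩
    · right
      have hbot : f₂.range ≤ ⊥ := by simpa [hm.ne'] using h₂
      exact ⟨fun x y ↦ hf₂ ((hbot ⟨x, rfl⟩ : f₂ x = 1).trans (hbot ⟨y, rfl⟩ : f₂ y = 1).symm)⟩

end KPoints

end AlgebraicGeometry

theorem proposition3 {K : Type*} [Field K] [IsAlgClosed K]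
    (G : Over (Spec (.of K))) [GrpObj G] [IsAlgebraicGroup G]
    (hZ : Subgroup.center (KPoints G) = ⊥) :
    (∀ (n : ℕ) (H : Fin n → Subgroup (KPoints G)),
      (∀ i, IsIndecomposableAlgebraic (H i)) →
      (⊤ : Subgroup (KPoints G)).IsDirectProdFamily H →
      ∀ Γ : Subgroup (KPoints G), IsZariskiDense Γ →
      ∀ A B : Subgroup (KPoints G), Γ.IsDirectProd A B →
      ∃ (σ : Equiv.Perm (Fin n)) (m : ℕ), m ≤ n ∧
        A ≤ (⨆ i : Fin n, ⨆ _ : (i : ℕ) < m, H (σ i)) ∧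
        B ≤ (⨆ i : Fin n, ⨆ _ : m ≤ (i : ℕ), H (σ i))) ∧
    (IsIndecomposableAlgebraic (⊤ : Subgroup (KPoints G)) →
      ∀ Γ : Subgroup (KPoints G), IsZariskiDense Γ → IsIndecomposableGroup Γ) := by
  exact ⟨fun _ _ hH hprod _ hΓ _ _ h ↦ KPoints.exists_perm_le_of_isDirectProd hZ hH hprod hΓ h,
    fun htop _ hΓ ↦ KPoints.isIndecomposableGroup_of_dense hZ htop hΓ⟩
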